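/- Let $\mathfrak H_0,\mathfrak H_1$ be complex Hilbert spaces with $n:=\dim\mathfrak H_1<\infty$, let $A_0\in\mathcal L(\mathfrak H_0)$, $A_1\in\mathcal L(\mathfrak H_1)$ be self-adjoint and $V\in\mathcal L(\mathfrak H_1,\mathfrak H_0)$, and assume that $\operatorname{lin\,span}\{A_0^k v : k\in\mathbb N_0,\ v\in\operatorname{Ran}V\}$ is dense in $\mathfrak H_0$. Let $\mathsf E_{A_0}$ be the spectral measure of $A_0$. For $y\in\mathfrak H_1$ and $\lambda\in\mathbb R$ put $$I(y,\lambda):=\int_{\mathbb R}\frac{1}{|t-\lambda|^2}\,d\langle Vy,\mathsf E_{A_0}(t)Vy\rangle\in[0,\infty],$$ the integrand being $\infty$ at $t=\lambda$, and consider the equation $$(A_1-\lambda)y=\lim_{\varepsilon\to0^+}V^*(A_0-\lambda-i\varepsilon)^{-1}Vy,\tag{$*$}$$ which includes the existence of the limit. Let $K_{pp}$ (respectively $K_{sc}$) be the set of all $\lambda\in\mathbb R$ for which there is a $0\ne y\in\mathfrak H_1$ satisfying $(*)$ and $I(y,\lambda)<\infty$ (respectively $I(y,\lambda)=\infty$).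 Let $y_1,\dots,y_n\in\mathfrak H_1$ be linearly independent and $\lambda_1,\dots,\lambda_n\in K_{pp}\cup K_{sc}$ such that $(*)$ holds for each pair $(y,\lambda)=(y_k,\lambda_k)$; write $\Lambda=\{(y_1,\lambda_1),\dots,(y_n,\lambda_n)\}$. Let $P_{\Lambda,k}:\mathfrak H_1\to\mathfrak H_1$ be the (not necessarily orthogonal) projection with range $\operatorname{span}\{y_k\}$ and kernel $\operatorname{span}\{y_j: j\neq k\}$. Define the operator $X_\Lambda:\mathfrak H_0\supset\operatorname{Dom}(X_\Lambda)\to\mathfrak H_1$ by $$X_\Lambda x=\lim_{\varepsilon\to0^+}\sum_{j=1}^nP_{\Lambda,j}^*V^*(A_0-\lambda_j+i\varepsilon)^{-1}x,$$ where $\operatorname{Dom}(X_\Lambda)$ is the set of all $x\in\mathfrak H_0$ for which this limit exists in $\mathfrak H_1$. Then: (i) $X_\Lambda$ is densely defined. (ii) If $I(y_j,\lambda_j)=\infty$ for at least one $j$ (that is, $\lambda_j\in K_{sc}$ with witness $y_j$), then $X_\Lambda$ is unbounded and non-closable. (iii) If $I(y_j,\lambda_j)<\infty$ for all $j$ (that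 is, $\lambda_j\in K_{pp}$ with witness $y_j$), then $X_\Lambda$ is bounded, i.e. there is a $C$ with $\|X_\Lambda x\|\le C\|x\|$ for all $x\in\operatorname{Dom}(X_\Lambda)$. (iv) $A_0x\in\operatorname{Dom}(X_\Lambda)$ for all $x\in\operatorname{Dom}(X_\Lambda)$. (v) $X_\Lambda$ is a strong solution of the Riccati equation $A_1X-XA_0-XVX+V^*=0$; that is, $X=X_\Lambda$ is densely defined, $(A_0+VX)x\in\operatorname{Dom}(X)$ and $A_1Xx-X(A_0+VX)x+V^*x=0$ for all $x\in\operatorname{Dom}(X)$. -/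

import Mathlib

open Filter Topology MeasureTheory
open scoped InnerProductSpace ENNReal CompactlySupported

noncomputable section

namespace Riccati

/-- `U` is a cyclic generating subspace for `T`: the linear span of `{T ^ k u | k ∈ ℕ, u ∈ U}`
is dense. -/
def IsCyclicGenerating {H : Type*} [NormedAddCommGroup H] [InnerProductSpace ℂ H]
    (T : H →L[ℂ] H) (U : Submodule ℂ H) : Prop :=
  Dense (Submodule.span ℂ {w : H | ∃ k : ℕ, ∃ u ∈ U, w = (T ^ k) u} : Set H)

/-- The operator `(T - z)⁻¹` (a genuine inverse whenever `z` is in the resolvent set of `T`). -/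
def res {H : Type*} [NormedAddCommGroup H] [InnerProductSpace ℂ H]
    (T : H →L[ℂ] H) (z : ℂ) : H →L[ℂ] H :=
  Ring.inverse (T - z • (1 : H →L[ℂ] H))

section SpectralMeasure

variable {H : Type*} [NormedAddCommGroup H] [InnerProductSpace ℂ H] [CompleteSpace H]

/-- The positive linear functional `f ↦ ⟨x, f(T) x⟩` on compactly supported continuous functions,
with `f(T)` given by the continuous functional calculus of the self-adjoint operator `T`. -/
def spectralFunctional (T : H →L[ℂ] H) (x : H) : C_c(ℝ, ℝ) →ₚ[ℝ] ℝ :=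
  PositiveLinearMap.mk₀
    { toFun := fun f => (⟪x, (cfc (f : ℝ → ℝ) T) x⟫_ℂ).re
      map_add' := by
        intro f g
        have h : cfc ((f + g : C_c(ℝ, ℝ)) : ℝ → ℝ) T
            = cfc (f : ℝ → ℝ) T + cfc (g : ℝ → ℝ) T := by
          rw [CompactlySupportedContinuousMap.coe_add]
          exact cfc_add (a := T) (f : ℝ → ℝ) (g : ℝ → ℝ) f.continuous.continuousOn
            g.continuous.continuousOn
        simp only [h, add_apply, inner_add_right, Complex.add_re]
      map_smul' := by
        intro c f
        have h : cfc ((c • f : C_c(ℝ, ℝ)) : ℝ → ℝ) T = c • cfc (f : ℝ → ℝ) T := by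
          rw [CompactlySupportedContinuousMap.coe_smul]
          exact cfc_smul (a := T) c (f : ℝ → ℝ) f.continuous.continuousOn
        simp only [h, smul_apply, RingHom.id_apply, smul_eq_mul]
        rw [← Complex.coe_smul, inner_smul_right, Complex.re_ofReal_mul] }
    (by
      intro f hf
      have h : (0 : H →L[ℂ] H) ≤ cfc (f : ℝ → ℝ) T := cfc_nonneg fun t _ => hf t
      rw [ContinuousLinearMap.nonneg_iff_isPositive] at h
      exact h.re_inner_nonneg_right x)

/-- The scalar spectral measure `Δ ↦ ⟨x, E_T(Δ) x⟩` of a bounded self-adjoint operator `T` at the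
vector `x`: the unique regular Borel measure `μ` on `ℝ` with `∫ f dμ = ⟨x, f(T) x⟩` for all
compactly supported continuous `f` (Riesz–Markov–Kakutani). -/
def spectralMeasure (T : H →L[ℂ] H) (x : H) : Measure ℝ :=
  RealRMK.rieszMeasure (spectralFunctional T x)

/-- The defining property of the scalar spectral measure. -/
theorem integral_spectralMeasure (T : H →L[ℂ] H) (x : H) (f : C_c(ℝ, ℝ)) :
    ∫ t, f t ∂(spectralMeasure T x) = (⟪x, (cfc (f : ℝ → ℝ) T) x⟫_ℂ).re :=
  RealRMK.integral_rieszMeasure (spectralFunctional T x) f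

/-- `∫ |t - lam|⁻² d⟨x, E_T(t) x⟩ ∈ [0, ∞]`, where the integrand is `∞` at `t = lam`. -/
def invSqIntegral (T : H →L[ℂ] H) (x : H) (lam : ℝ) : ℝ≥0∞ :=
  ∫⁻ t, (ENNReal.ofReal (|t - lam| ^ 2))⁻¹ ∂(spectralMeasure T x)

end SpectralMeasure

variable {H₀ H₁ : Type*}
  [NormedAddCommGroup H₀] [InnerProductSpace ℂ H₀] [CompleteSpace H₀]
  [NormedAddCommGroup H₁] [InnerProductSpace ℂ H₁] [CompleteSpace H₁]

/-- `(A₁ - lam) y = lim_{ε → 0⁺} V* (A₀ - lam - i ε)⁻¹ V y`, the limit being part of the claim. -/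
def LimitEquation (A₀ : H₀ →L[ℂ] H₀) (A₁ : H₁ →L[ℂ] H₁) (V : H₁ →L[ℂ] H₀)
    (y : H₁) (lam : ℝ) : Prop :=
  Tendsto (fun ε : ℝ =>
      ContinuousLinearMap.adjoint V (res A₀ ((lam : ℂ) + Complex.I * (ε : ℂ)) (V y)))
    (𝓝[>] 0) (𝓝 (A₁ y - (lam : ℂ) • y))

/-- The set `K_pp`. -/
def Kpp (A₀ : H₀ →L[ℂ] H₀) (A₁ : H₁ →L[ℂ] H₁) (V : H₁ →L[ℂ] H₀) : Set ℝ :=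
  {lam | ∃ y : H₁, y ≠ 0 ∧ LimitEquation A₀ A₁ V y lam ∧ invSqIntegral A₀ (V y) lam < ∞}

/-- The set `K_sc`. -/
def Ksc (A₀ : H₀ →L[ℂ] H₀) (A₁ : H₁ →L[ℂ] H₁) (V : H₁ →L[ℂ] H₀) : Set ℝ :=
  {lam | ∃ y : H₁, y ≠ 0 ∧ LimitEquation A₀ A₁ V y lam ∧ invSqIntegral A₀ (V y) lam = ∞}

section Projections

variable [FiniteDimensional ℂ H₁] {n : ℕ}

/-- For `n = dim H₁` linearly independent vectors `y j`, the (in general oblique) projection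
in `H₁` onto `span {y k}` along `span {y j | j ≠ k}`. -/
def obliqueProj (hn : n = Module.finrank ℂ H₁) (y : Fin n → H₁) (hy : LinearIndependent ℂ y)
    (k : Fin n) : H₁ →L[ℂ] H₁ :=
  LinearMap.toContinuousLinearMap
    (((basisOfLinearIndependentOfCardEqFinrank' y hy (by simpa using hn)).coord k).smulRight
      (y k))

theorem obliqueProj_apply (hn : n = Module.finrank ℂ H₁) (y : Fin n → H₁)
    (hy : LinearIndependent ℂ y) (k j : Fin n) :
    obliqueProj hn y hy k (y j) = if j = k then y k else 0 := by
  have h : (basisOfLinearIndependentOfCardEqFinrank' y hy (by simpa using hn)) j = y j := by simp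
  conv_lhs => rw [← h]
  simp only [obliqueProj, LinearMap.coe_toContinuousLinearMap', LinearMap.smulRight_apply,
    Module.Basis.coord_apply, Module.Basis.repr_self, Finsupp.single_apply]
  split_ifs <;> simp

/-- `∑ j, P_j* V* (A₀ - lam j + i ε)⁻¹`. -/
def XApprox (A₀ : H₀ →L[ℂ] H₀) (V : H₁ →L[ℂ] H₀) (hn : n = Module.finrank ℂ H₁)
    (y : Fin n → H₁) (hy : LinearIndependent ℂ y) (lam : Fin n → ℝ) (ε : ℝ) : H₀ →L[ℂ] H₁ :=
  ∑ j, (ContinuousLinearMap.adjoint (obliqueProj hn y hy j)).comp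
    ((ContinuousLinearMap.adjoint V).comp
      (res A₀ ((lam j : ℂ) - Complex.I * (ε : ℂ))))

/-- The possibly unbounded operator `X_Λ`, `Λ = {(y j, lam j)}`: its domain consists of all `x` for
which `∑ j, P_j* V* (A₀ - lam j + i ε)⁻¹ x` converges as `ε → 0⁺`, its value is that limit. -/
def XLambda (A₀ : H₀ →L[ℂ] H₀) (V : H₁ →L[ℂ] H₀) (hn : n = Module.finrank ℂ H₁)
    (y : Fin n → H₁) (hy : LinearIndependent ℂ y) (lam : Fin n → ℝ) : H₀ →ₗ.[ℂ] H₁ where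
  domain :=
    { carrier := {x | ∃ l : H₁,
        Tendsto (fun ε : ℝ => XApprox A₀ V hn y hy lam ε x) (𝓝[>] 0) (𝓝 l)}
      zero_mem' := ⟨0, by simp⟩
      add_mem' := by
        rintro a b ⟨l, hl⟩ ⟨m, hm⟩
        exact ⟨l + m, by simpa only [map_add] using hl.add hm⟩
      smul_mem' := by
        rintro c a ⟨l, hl⟩
        exact ⟨c • l, by simpa only [map_smul] using hl.const_smul c⟩ }
  toFun :=
    { toFun := fun x => x.2.choose
      map_add' := fun a b => tendsto_nhds_unique (a + b).2.choose_spec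
        (by simpa only [Submodule.coe_add, map_add] using a.2.choose_spec.add b.2.choose_spec)
      map_smul' := fun c a => tendsto_nhds_unique (c • a).2.choose_spec
        (by simpa only [Submodule.coe_smul, map_smul, RingHom.id_apply]
              using a.2.choose_spec.const_smul c) }

theorem XLambda_tendsto (A₀ : H₀ →L[ℂ] H₀) (V : H₁ →L[ℂ] H₀) (hn : n = Module.finrank ℂ H₁)
    (y : Fin n → H₁) (hy : LinearIndependent ℂ y) (lam : Fin n → ℝ)
    (x : (XLambda A₀ V hn y hy lam).domain) :
    Tendsto (fun ε : ℝ => XApprox A₀ V hn y hy lam ε x) (𝓝[>] 0)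
      (𝓝 (XLambda A₀ V hn y hy lam x)) :=
  x.2.choose_spec

end Projections

/-- Boundedness of a (partially defined) linear operator on its domain. -/
def IsBoundedOp (X : H₀ →ₗ.[ℂ] H₁) : Prop :=
  ∃ C : ℝ, ∀ x : X.domain, ‖X x‖ ≤ C * ‖(x : H₀)‖

/-- `X` is a strong solution of `A₁ X - X A₀ - X V X + V* = 0`. -/
structure IsStrongSolution (A₀ : H₀ →L[ℂ] H₀) (A₁ : H₁ →L[ℂ] H₁) (V : H₁ →L[ℂ] H₀)
    (X : H₀ →ₗ.[ℂ] H₁) : Prop where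
  dense_domain : Dense (X.domain : Set H₀)
  mapsTo : ∀ x : X.domain, A₀ x + V (X x) ∈ X.domain
  equation : ∀ x : X.domain,
    A₁ (X x) - X ⟨A₀ x + V (X x), mapsTo x⟩ + ContinuousLinearMap.adjoint V (x : H₀) = 0

end Riccati

end

namespace Riccati

/-! ### Resolvent identities and estimates for a bounded self-adjoint operator. -/

section Resolvent

variable {H : Type*} [NormedAddCommGroup H] [InnerProductSpace ℂ H] [CompleteSpace H]

/-! Write R(z) for the resolvent of A₀. Pairing with the basis y decouples the sum defining X_Λ:
since P_j y_k = δ_jk y_k, the k-th coordinate of the approximant at x is ⟨R(λ_k + iε) V y_k, x⟩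
(`inner_XApprox`). Everything reduces to limits of these n scalars.

Equation (*) makes them converge on Ran V (`tendsto_inner_res_V`), and A₀ R(z) = 1 + z R(z) carries
convergence from x to A₀ x (`tendsto_inner_res_apply`). Cyclicity then gives a dense domain, and
adding the two limit formulas gives the Riccati equation.

Boundedness rests on ‖R(λ + iε) v‖² = ∫ ((t - λ)² + ε²)⁻¹ dμ_v: this is at most I, so finite I gives
bounded coordinates. Conversely, if X_Λ is bounded, Riesz representation yields w with (A₀ - λ_j) w
= V y_j; the resolvents of V y_j are then uniformly bounded, and Fatou makes I finite. As the target
is finite-dimensional, closability would already force boundedness. -/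

theorem isUnit_sub_smul_one {T : H →L[ℂ] H} (hT : IsSelfAdjoint T) {z : ℂ} (hz : z.im ≠ 0) :
    IsUnit (T - z • (1 : H →L[ℂ] H)) := by
  have h : z ∉ spectrum ℂ T := fun h => hz (by
    rw [hT.mem_spectrum_eq_re h, Complex.ofReal_im])
  rw [spectrum.notMem_iff, Algebra.algebraMap_eq_smul_one] at h
  simpa using h.neg

theorem apply_res {T : H →L[ℂ] H} (hT : IsSelfAdjoint T) {z : ℂ} (hz : z.im ≠ 0) (x : H) :
    T (res T z x) - z • res T z x = x := by
  have h := congrArg (fun S : H →L[ℂ] H => S x)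
    (Ring.mul_inverse_cancel _ (isUnit_sub_smul_one hT hz))
  simpa [res] using h

theorem inner_apply_left {T : H →L[ℂ] H} (hT : IsSelfAdjoint T) (x w : H) :
    ⟪T x, w⟫_ℂ = ⟪x, T w⟫_ℂ :=
  hT.isSymmetric x w

theorem inner_res_conj {T : H →L[ℂ] H} (hT : IsSelfAdjoint T) {z : ℂ} (hz : z.im ≠ 0)
    (v x : H) : ⟪v, res T (starRingEnd ℂ z) x⟫_ℂ = ⟪res T z v, x⟫_ℂ := by
  have hz' : (starRingEnd ℂ z).im ≠ 0 := by simpa using hz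
  conv_lhs => rw [← apply_res hT hz v]
  conv_rhs => rw [← apply_res hT hz' x]
  rw [inner_sub_left, inner_sub_right, inner_apply_left hT, inner_smul_left, inner_smul_right]

/-- The cross term vanishes: ⟨(T - lam) u, u⟩ is real, so multiplying it by iε leaves no real part.
-/
theorem norm_sub_sq_eq {T : H →L[ℂ] H} (hT : IsSelfAdjoint T) (lam ε : ℝ) (u : H) :
    ‖T u - ((lam : ℂ) + Complex.I * (ε : ℂ)) • u‖ ^ 2
      = ‖T u - (lam : ℂ) • u‖ ^ 2 + ε ^ 2 * ‖u‖ ^ 2 := by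
  have hre : (⟪T u - (lam : ℂ) • u, (Complex.I * (ε : ℂ)) • u⟫_ℂ).re = 0 := by
    have hT' : (⟪T u, u⟫_ℂ).im = 0 := hT.isSymmetric.im_inner_apply_self u
    have hu : ((‖u‖ : ℂ) ^ 2).im = 0 := by exact_mod_cast Complex.ofReal_im (‖u‖ ^ 2)
    simp [hT', hu]
  have h : T u - ((lam : ℂ) + Complex.I * (ε : ℂ)) • u
      = (T u - (lam : ℂ) • u) - (Complex.I * (ε : ℂ)) • u := by rw [add_smul]; abel
  rw [h, @norm_sub_sq ℂ, RCLike.re_eq_complex_re, hre, norm_smul]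
  simp [mul_pow]

/-- If `(T - lam) w = v`, then the resolvents `(T - lam - i ε)⁻¹ v` stay within `2 ‖w‖`. -/
theorem norm_res_le_of_eq {T : H →L[ℂ] H} (hT : IsSelfAdjoint T) {lam ε : ℝ} (hε : 0 < ε)
    {v w : H} (hw : T w - (lam : ℂ) • w = v) :
    ‖res T ((lam : ℂ) + Complex.I * (ε : ℂ)) v‖ ≤ 2 * ‖w‖ := by
  set z : ℂ := (lam : ℂ) + Complex.I * (ε : ℂ) with hz
  have hzi : z.im ≠ 0 := by simp [hz, hε.ne']
  -- Since (T - z) w = v - iε w, the error R(z) v - w is a resolvent applied to iε w; the factor ε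
  -- cancels the blow-up of the resolvent.
  have h1 : T (res T z v - w) - z • (res T z v - w) = (Complex.I * (ε : ℂ)) • w := by
    have h2 := apply_res hT hzi v
    rw [← hw] at h2 ⊢
    rw [map_sub, smul_sub, sub_sub_sub_comm, h2, hz, add_smul]
    abel
  have h3 := norm_sub_sq_eq hT lam ε (res T z v - w)
  rw [← hz, h1, norm_smul, mul_pow] at h3
  have h4 : ‖Complex.I * (ε : ℂ)‖ = ε := by simp [abs_of_pos hε]
  rw [h4] at h3
  have h5 : ‖res T z v - w‖ ≤ ‖w‖ := by
    refine le_of_sq_le_sq ?_ (norm_nonneg _)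
    have : ε ^ 2 * ‖res T z v - w‖ ^ 2 ≤ ε ^ 2 * ‖w‖ ^ 2 := by
      rw [h3]; linarith [sq_nonneg ‖T (res T z v - w) - (lam : ℂ) • (res T z v - w)‖]
    exact le_of_mul_le_mul_left this (by positivity)
  calc ‖res T z v‖ = ‖(res T z v - w) + w‖ := by rw [sub_add_cancel]
    _ ≤ ‖res T z v - w‖ + ‖w‖ := norm_add_le _ _
    _ ≤ 2 * ‖w‖ := by linarith

/-- The denominator factors as (t - z)(t - z̄), so the functional calculus gives R(z̄) R(z), and
R(z̄) is the adjoint of R(z). -/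
theorem inner_cfc_eq_norm_res_sq {T : H →L[ℂ] H} (hT : IsSelfAdjoint T) {lam ε : ℝ}
    (hε : 0 < ε) (x : H) :
    ⟪x, cfc (fun t : ℝ => ((t - lam) ^ 2 + ε ^ 2)⁻¹) T x⟫_ℂ
      = ((‖res T ((lam : ℂ) + Complex.I * (ε : ℂ)) x‖ ^ 2 : ℝ) : ℂ) := by
  set z : ℂ := (lam : ℂ) + Complex.I * (ε : ℂ) with hz
  have hzi : z.im ≠ 0 := by simp [hz, hε.ne']
  have hzc : (starRingEnd ℂ z).im ≠ 0 := by simpa using hzi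
  have hpos : ∀ t : ℝ, (t - lam) ^ 2 + ε ^ 2 ≠ 0 := fun t => by positivity
  have hcont : Continuous fun t : ℝ => ((t - lam) ^ 2 + ε ^ 2)⁻¹ :=
    Continuous.inv₀ (by fun_prop) hpos
  have hpoly : cfc (fun t : ℝ => (t - lam) ^ 2 + ε ^ 2) T
      = (T - z • 1) * (T - (starRingEnd ℂ z) • 1) := by
    have h1 : cfc (fun t : ℝ => (t - lam) ^ 2 + ε ^ 2) T
        = (T - algebraMap ℝ _ lam) ^ 2 + algebraMap ℝ _ (ε ^ 2) := by
      rw [cfc_add_const (ε ^ 2) (fun t : ℝ => (t - lam) ^ 2) T,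
        cfc_pow (fun t : ℝ => t - lam) 2 T, cfc_sub (fun t : ℝ => t) (fun _ => lam) T,
        cfc_id' ℝ T, cfc_const lam T]
    rw [h1]
    have h2 : (algebraMap ℝ (H →L[ℂ] H)) lam = (lam : ℂ) • 1 := by
      rw [Algebra.algebraMap_eq_smul_one]; exact (Complex.coe_smul _ _).symm
    have h3 : (algebraMap ℝ (H →L[ℂ] H)) (ε ^ 2) = ((ε ^ 2 : ℝ) : ℂ) • 1 := by
      rw [Algebra.algebraMap_eq_smul_one]; exact (Complex.coe_smul _ _).symm
    rw [h2, h3]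
    ext u
    have h4 : z * starRingEnd ℂ z = (lam : ℂ) ^ 2 + (ε : ℂ) ^ 2 := by
      simp only [hz, map_add, map_mul, Complex.conj_I, Complex.conj_ofReal]
      linear_combination -(ε : ℂ) ^ 2 * Complex.I_sq
    have h5 : z + starRingEnd ℂ z = 2 * (lam : ℂ) := by
      simp only [hz, map_add, map_mul, Complex.conj_I, Complex.conj_ofReal]
      ring
    have h6 : starRingEnd ℂ z = 2 * (lam : ℂ) - z := by rw [← h5]; ring
    have h7 : (lam : ℂ) ^ 2 + (ε : ℂ) ^ 2 = z * (2 * (lam : ℂ) - z) := by rw [← h6, h4]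
    have h8 : (ε : ℂ) ^ 2 = z * (2 * (lam : ℂ) - z) - (lam : ℂ) ^ 2 := by rw [← h7]; ring
    simp only [pow_two (T - (lam : ℂ) • (1 : H →L[ℂ] H)), h6, Complex.ofReal_pow, h8, add_apply,
      ContinuousLinearMap.mul_def, ContinuousLinearMap.comp_apply, sub_apply, smul_apply,
      one_apply_eq_self, map_sub, map_smul]
    module
  have hmul : cfc (fun t : ℝ => ((t - lam) ^ 2 + ε ^ 2)⁻¹) T
      * ((T - z • 1) * (T - (starRingEnd ℂ z) • 1)) = 1 := by
    rw [← hpoly, ← cfc_mul _ _ T hcont.continuousOn (by fun_prop)]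
    simp only [inv_mul_cancel₀ (hpos _)]
    exact cfc_const_one ℝ T
  have hcomm : res T (starRingEnd ℂ z) (res T z x)
      = cfc (fun t : ℝ => ((t - lam) ^ 2 + ε ^ 2)⁻¹) T x := by
    have h := congrArg (fun S : H →L[ℂ] H => S (res T (starRingEnd ℂ z) (res T z x))) hmul
    simp only [ContinuousLinearMap.mul_def, ContinuousLinearMap.comp_apply, sub_apply, smul_apply,
      one_apply_eq_self] at h
    rw [apply_res hT hzc, apply_res hT hzi] at h
    exact h.symm
  rw [← hcomm, inner_res_conj hT hzi, inner_self_eq_norm_sq_to_K]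
  simp

end Resolvent

end Riccati

/-! ### Resolvent norms as integrals against the spectral measure. -/

noncomputable section

namespace Riccati

/-- The piecewise linear cutoff which is `1` on `[-m, m]` and `0` off `[-(m + 1), m + 1]`. -/
def cutoff (m t : ℝ) : ℝ := max 0 (min 1 (m + 1 - |t|))

theorem continuous_cutoff (m : ℝ) : Continuous (cutoff m) := by
  unfold cutoff; fun_prop

theorem cutoff_nonneg (m t : ℝ) : 0 ≤ cutoff m t := le_max_left _ _

theorem cutoff_le_one (m t : ℝ) : cutoff m t ≤ 1 := by simp [cutoff]

theorem cutoff_eq_one {m t : ℝ} (h : |t| ≤ m) : cutoff m t = 1 := by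
  unfold cutoff
  rw [min_eq_left (by linarith), max_eq_right zero_le_one]

theorem hasCompactSupport_cutoff (m : ℝ) : HasCompactSupport (cutoff m) := by
  refine HasCompactSupport.intro (isCompact_Icc (a := -(m + 1)) (b := m + 1)) fun t ht => ?_
  have h : m + 1 < |t| := by
    by_contra! h
    exact ht (Set.mem_Icc.2 (abs_le.1 h))
  unfold cutoff
  exact max_eq_left ((min_le_right _ _).trans (by linarith))

/-- The compactly supported function `t ↦ χ(t) / ((t - lam)² + ε²)`, `χ` a cutoff function. -/
def cutoffKernel (m lam : ℝ) {ε : ℝ} (hε : 0 < ε) : C_c(ℝ, ℝ) where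
  toFun t := cutoff m t * ((t - lam) ^ 2 + ε ^ 2)⁻¹
  continuous_toFun := (continuous_cutoff m).mul
    (Continuous.inv₀ (by fun_prop) fun t => by positivity)
  hasCompactSupport' := (hasCompactSupport_cutoff m).mul_right

theorem cutoffKernel_apply (m lam : ℝ) {ε : ℝ} (hε : 0 < ε) (t : ℝ) :
    cutoffKernel m lam hε t = cutoff m t * ((t - lam) ^ 2 + ε ^ 2)⁻¹ := rfl

theorem cutoffKernel_nonneg (m lam : ℝ) {ε : ℝ} (hε : 0 < ε) (t : ℝ) :
    0 ≤ cutoffKernel m lam hε t :=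
  mul_nonneg (cutoff_nonneg m t) (by positivity)

variable {H : Type*} [NormedAddCommGroup H] [InnerProductSpace ℂ H] [CompleteSpace H]

instance isFiniteMeasureOnCompacts_spectralMeasure (T : H →L[ℂ] H) (x : H) :
    IsFiniteMeasureOnCompacts (spectralMeasure T x) := by
  unfold spectralMeasure RealRMK.rieszMeasure
  infer_instance

theorem exists_abs_le_of_mem_spectrum (T : H →L[ℂ] H) :
    ∃ M : ℝ, ∀ t ∈ spectrum ℝ T, |t| ≤ M := by
  obtain ⟨M, hM⟩ := (spectrum.isCompact (𝕜 := ℝ) T).isBounded.exists_norm_le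
  exact ⟨M, hM⟩

/-- The measure is tested only on compactly supported functions; a cutoff equal to 1 on the spectrum
does not change the functional calculus. -/
theorem lintegral_cutoffKernel {T : H →L[ℂ] H} (hT : IsSelfAdjoint T) {m lam ε : ℝ}
    (hm : ∀ t ∈ spectrum ℝ T, |t| ≤ m) (hε : 0 < ε) (x : H) :
    ∫⁻ t, ENNReal.ofReal (cutoffKernel m lam hε t) ∂(spectralMeasure T x)
      = ENNReal.ofReal (‖res T ((lam : ℂ) + Complex.I * (ε : ℂ)) x‖ ^ 2) := by
  have hcfc : cfc (cutoffKernel m lam hε : ℝ → ℝ) T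
      = cfc (fun t : ℝ => ((t - lam) ^ 2 + ε ^ 2)⁻¹) T :=
    cfc_congr fun t ht => by
      rw [cutoffKernel_apply, cutoff_eq_one (hm t ht), one_mul]
  have hint : Integrable (cutoffKernel m lam hε) (spectralMeasure T x) :=
    (cutoffKernel m lam hε).continuous.integrable_of_hasCompactSupport
      (cutoffKernel m lam hε).hasCompactSupport
  rw [← ofReal_integral_eq_lintegral_ofReal hint
    (Eventually.of_forall (cutoffKernel_nonneg m lam hε)),
    integral_spectralMeasure, hcfc, inner_cfc_eq_norm_res_sq hT hε, Complex.ofReal_re]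

theorem norm_res_sq_le_invSqIntegral {T : H →L[ℂ] H} (hT : IsSelfAdjoint T) {lam ε : ℝ}
    (hε : 0 < ε) (x : H) :
    ENNReal.ofReal (‖res T ((lam : ℂ) + Complex.I * (ε : ℂ)) x‖ ^ 2) ≤ invSqIntegral T x lam := by
  obtain ⟨m, hm⟩ := exists_abs_le_of_mem_spectrum T
  rw [← lintegral_cutoffKernel hT hm hε, invSqIntegral]
  refine lintegral_mono fun t => ?_
  have hp : 0 < (t - lam) ^ 2 + ε ^ 2 := by positivity
  calc ENNReal.ofReal (cutoffKernel m lam hε t)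
      ≤ ENNReal.ofReal ((t - lam) ^ 2 + ε ^ 2)⁻¹ := ENNReal.ofReal_le_ofReal
        (mul_le_of_le_one_left (inv_nonneg.2 hp.le) (cutoff_le_one m t))
    _ = (ENNReal.ofReal ((t - lam) ^ 2 + ε ^ 2))⁻¹ := ENNReal.ofReal_inv_of_pos hp
    _ ≤ (ENNReal.ofReal (|t - lam| ^ 2))⁻¹ := by
        rw [ENNReal.inv_le_inv, sq_abs]
        exact ENNReal.ofReal_le_ofReal (by nlinarith)

/-- Fatou's lemma along ε = 1/(k + 1). -/
theorem invSqIntegral_le_of_norm_res_le {T : H →L[ℂ] H} (hT : IsSelfAdjoint T) {lam C : ℝ} {x : H}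
    (hC : ∀ ε : ℝ, 0 < ε → ‖res T ((lam : ℂ) + Complex.I * (ε : ℂ)) x‖ ≤ C) :
    invSqIntegral T x lam ≤ ENNReal.ofReal (C ^ 2) := by
  obtain ⟨M, hM⟩ := exists_abs_le_of_mem_spectrum T
  have hpos : ∀ k : ℕ, (0 : ℝ) < 1 / ((k : ℝ) + 1) := fun k => by positivity
  -- The cutoff radius grows with k, so convergence holds at every real t and the support of the
  -- measure need not be located. At t = lam the limit is 0⁻¹ = ∞.
  set F : ℕ → ℝ → ℝ≥0∞ := fun k t =>
    ENNReal.ofReal (cutoffKernel (M + k) lam (hpos k) t) with hF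
  have hlim : ∀ t, Tendsto (fun k => F k t) atTop (𝓝 (ENNReal.ofReal (|t - lam| ^ 2))⁻¹) := by
    intro t
    have h1 : ∀ᶠ k : ℕ in atTop,
        (ENNReal.ofReal ((t - lam) ^ 2 + (1 / ((k : ℝ) + 1)) ^ 2))⁻¹ = F k t := by
      obtain ⟨N, hN⟩ := exists_nat_ge (|t| - M)
      filter_upwards [eventually_ge_atTop N] with k hk
      have hk' : (N : ℝ) ≤ k := by exact_mod_cast hk
      have hp : 0 < (t - lam) ^ 2 + (1 / ((k : ℝ) + 1)) ^ 2 := by positivity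
      rw [hF]
      simp only [cutoffKernel_apply]
      rw [cutoff_eq_one (by linarith), one_mul, ENNReal.ofReal_inv_of_pos hp]
    refine Tendsto.congr' h1 (tendsto_inv_iff.2 (ENNReal.tendsto_ofReal ?_))
    have h2 : Tendsto (fun k : ℕ => (t - lam) ^ 2 + (1 / ((k : ℝ) + 1)) ^ 2) atTop
        (𝓝 ((t - lam) ^ 2 + 0 ^ 2)) :=
      (tendsto_one_div_add_atTop_nhds_zero_nat.pow 2).const_add _
    simpa [sq_abs] using h2
  have hFm : ∀ k, Measurable (F k) := fun k =>
    (cutoffKernel (M + k) lam (hpos k)).continuous.measurable.ennreal_ofReal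
  calc invSqIntegral T x lam
      = ∫⁻ t, liminf (fun k => F k t) atTop ∂(spectralMeasure T x) :=
        lintegral_congr fun t => ((hlim t).liminf_eq).symm
    _ ≤ liminf (fun k => ∫⁻ t, F k t ∂(spectralMeasure T x)) atTop := lintegral_liminf_le hFm
    _ ≤ ENNReal.ofReal (C ^ 2) := by
        refine (liminf_le_liminf (v := fun _ : ℕ => ENNReal.ofReal (C ^ 2))
          (Eventually.of_forall fun k => ?_)).trans_eq (liminf_const _)
        have hk : ∀ t ∈ spectrum ℝ T, |t| ≤ M + k := fun t ht =>
          (hM t ht).trans (le_add_of_nonneg_right k.cast_nonneg)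
        rw [hF]
        simp only
        rw [lintegral_cutoffKernel hT hk]
        exact ENNReal.ofReal_le_ofReal (pow_le_pow_left₀ (norm_nonneg _) (hC _ (hpos k)) 2)

end Riccati

end

noncomputable section

namespace Riccati

/-! ### Coordinates given by pairing with a basis. -/

section Coordinates

variable {H : Type*} [NormedAddCommGroup H] [InnerProductSpace ℂ H] [FiniteDimensional ℂ H]
  {n : ℕ}

theorem ext_inner_of_linearIndependent (hn : n = Module.finrank ℂ H) {y : Fin n → H}
    (hy : LinearIndependent ℂ y) {u w : H} (h : ∀ k, ⟪y k, u⟫_ℂ = ⟪y k, w⟫_ℂ) : u = w :=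
  InnerProductSpace.ext_inner_left_basis (𝕜 := ℂ)
    (basisOfLinearIndependentOfCardEqFinrank' y hy (by simpa using hn))
    fun k => by simpa using h k

/-- The coordinates `u ↦ (⟨y k, u⟩)_k`. -/
def innerCoord (hn : n = Module.finrank ℂ H) (y : Fin n → H) (hy : LinearIndependent ℂ y) :
    H ≃L[ℂ] (Fin n → ℂ) :=
  ((LinearMap.pi fun k => (innerSL ℂ (y k) : H →ₗ[ℂ] ℂ)).linearEquivOfInjective
    (fun _ _ h => ext_inner_of_linearIndependent hn hy fun k => congrFun h k)
    (by simpa using hn.symm)).toContinuousLinearEquiv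

theorem innerCoord_apply (hn : n = Module.finrank ℂ H) (y : Fin n → H)
    (hy : LinearIndependent ℂ y) (u : H) (k : Fin n) :
    innerCoord hn y hy u k = ⟪y k, u⟫_ℂ := rfl

theorem exists_tendsto_of_inner {ι : Type*} {l : Filter ι} (hn : n = Module.finrank ℂ H)
    {y : Fin n → H} (hy : LinearIndependent ℂ y) {F : ι → H} {c : Fin n → ℂ}
    (h : ∀ k, Tendsto (fun i => ⟪y k, F i⟫_ℂ) l (𝓝 (c k))) : ∃ u, Tendsto F l (𝓝 u) := by
  have h1 : Tendsto (fun i => innerCoord hn y hy (F i)) l (𝓝 c) := tendsto_pi_nhds.2 h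
  have h2 := ((innerCoord hn y hy).symm.continuous.tendsto c).comp h1
  exact ⟨_, h2.congr fun i => (innerCoord hn y hy).symm_apply_apply (F i)⟩

end Coordinates

/-! ### Closability with finite-dimensional range space. -/

section Closable

variable {H₀ H₁ : Type*}
  [NormedAddCommGroup H₀] [InnerProductSpace ℂ H₀]
  [NormedAddCommGroup H₁] [InnerProductSpace ℂ H₁] [FiniteDimensional ℂ H₁]

/-- A closable operator with values in a finite-dimensional space is bounded. -/
theorem isBoundedOp_of_isClosable {X : H₀ →ₗ.[ℂ] H₁} (hX : X.IsClosable) : IsBoundedOp X := by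
  by_contra hb
  unfold IsBoundedOp at hb
  push Not at hb
  choose x hx using fun k : ℕ => hb (k + 1)
  have hpos : ∀ k, 0 < ‖X (x k)‖ := fun k => lt_of_le_of_lt (by positivity) (hx k)
  -- Normalised so that X u_k has norm 1 while ‖u_k‖ ≤ 1/(k + 1). Compactness of the sphere then
  -- puts some (0, z) with ‖z‖ = 1 in the closed graph.
  set u : ℕ → X.domain := fun k => ((‖X (x k)‖⁻¹ : ℝ) : ℂ) • x k with hu
  have hXu : ∀ k, X (u k) ∈ Metric.sphere (0 : H₁) 1 := fun k => by
    rw [mem_sphere_zero_iff_norm, hu]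
    rw [LinearPMap.map_smul, norm_smul, Complex.norm_real, norm_inv, norm_norm,
      inv_mul_cancel₀ (hpos k).ne']
  have hu0 : Tendsto (fun k => (u k : H₀)) atTop (𝓝 0) := by
    refine squeeze_zero_norm (fun k => ?_) tendsto_one_div_add_atTop_nhds_zero_nat
    rw [hu]
    simp only [Submodule.coe_smul]
    rw [norm_smul, Complex.norm_real, norm_inv, norm_norm, inv_mul_le_iff₀ (hpos k),
      mul_one_div, le_div_iff₀ (by positivity), mul_comm]
    exact (hx k).le
  obtain ⟨z, hz, φ, hφ, hlim⟩ :=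
    (have := FiniteDimensional.proper ℂ H₁; isCompact_sphere (0 : H₁) 1).tendsto_subseq hXu
  obtain ⟨X', hX'⟩ := hX
  have hmem : ((0 : H₀), z) ∈ X'.graph := by
    rw [← hX', ← SetLike.mem_coe, Submodule.topologicalClosure_coe]
    exact mem_closure_of_tendsto ((hu0.comp hφ.tendsto_atTop).prodMk_nhds hlim)
      (Eventually.of_forall fun k => X.mem_graph (u (φ k)))
  have hz0 : z = 0 := X'.graph_fst_eq_zero_snd hmem rfl
  rw [hz0] at hz
  simp at hz

end Closable

/-! ### The operator X_Λ: domain, Riccati equation, boundedness. -/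

variable {H₀ H₁ : Type*}
  [NormedAddCommGroup H₀] [InnerProductSpace ℂ H₀] [CompleteSpace H₀]
  [NormedAddCommGroup H₁] [InnerProductSpace ℂ H₁] [CompleteSpace H₁]
  [FiniteDimensional ℂ H₁] {n : ℕ}
  {A₀ : H₀ →L[ℂ] H₀} {A₁ : H₁ →L[ℂ] H₁} {V : H₁ →L[ℂ] H₀}
  {hn : n = Module.finrank ℂ H₁} {y : Fin n → H₁} {hy : LinearIndependent ℂ y} {lam : Fin n → ℝ}

theorem inner_XApprox (hA₀ : IsSelfAdjoint A₀) (k : Fin n) {ε : ℝ} (hε : 0 < ε) (x : H₀) :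
    ⟪y k, XApprox A₀ V hn y hy lam ε x⟫_ℂ
      = ⟪res A₀ ((lam k : ℂ) + Complex.I * (ε : ℂ)) (V (y k)), x⟫_ℂ := by
  have hz : ((lam k : ℂ) + Complex.I * (ε : ℂ)).im ≠ 0 := by simp [hε.ne']
  have hconj : (lam k : ℂ) - Complex.I * (ε : ℂ)
      = starRingEnd ℂ ((lam k : ℂ) + Complex.I * (ε : ℂ)) := by
    simp [sub_eq_add_neg]
  rw [XApprox, sum_apply, inner_sum, Finset.sum_eq_single k]
  · simp only [ContinuousLinearMap.comp_apply]
    rw [ContinuousLinearMap.adjoint_inner_right, obliqueProj_apply, if_pos rfl,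
      ContinuousLinearMap.adjoint_inner_right, hconj, inner_res_conj hA₀ hz]
  · intro j _ hj
    simp only [ContinuousLinearMap.comp_apply]
    rw [ContinuousLinearMap.adjoint_inner_right, obliqueProj_apply, if_neg hj.symm,
      inner_zero_left]
  · simp

theorem mem_domain_XLambda_of_tendsto (hA₀ : IsSelfAdjoint A₀) {x : H₀} {c : Fin n → ℂ}
    (h : ∀ k, Tendsto (fun ε : ℝ =>
      ⟪res A₀ ((lam k : ℂ) + Complex.I * (ε : ℂ)) (V (y k)), x⟫_ℂ) (𝓝[>] 0) (𝓝 (c k))) :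
    x ∈ (XLambda A₀ V hn y hy lam).domain :=
  exists_tendsto_of_inner hn hy fun k => (h k).congr' (by
    filter_upwards [self_mem_nhdsWithin] with ε hε
    exact (inner_XApprox hA₀ k hε x).symm)

theorem tendsto_inner_XLambda (hA₀ : IsSelfAdjoint A₀) (x : (XLambda A₀ V hn y hy lam).domain)
    (k : Fin n) :
    Tendsto (fun ε : ℝ =>
      ⟪res A₀ ((lam k : ℂ) + Complex.I * (ε : ℂ)) (V (y k)), (x : H₀)⟫_ℂ) (𝓝[>] 0)
      (𝓝 ⟪y k, XLambda A₀ V hn y hy lam x⟫_ℂ) :=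
  (tendsto_const_nhds.inner (𝕜 := ℂ) (XLambda_tendsto A₀ V hn y hy lam x)).congr' (by
    filter_upwards [self_mem_nhdsWithin] with ε hε
    exact inner_XApprox hA₀ k hε x)

theorem inner_XLambda_eq (hA₀ : IsSelfAdjoint A₀) {x : H₀}
    (hx : x ∈ (XLambda A₀ V hn y hy lam).domain) {k : Fin n} {c : ℂ}
    (h : Tendsto (fun ε : ℝ =>
      ⟪res A₀ ((lam k : ℂ) + Complex.I * (ε : ℂ)) (V (y k)), x⟫_ℂ) (𝓝[>] 0) (𝓝 c)) :
    ⟪y k, XLambda A₀ V hn y hy lam ⟨x, hx⟩⟫_ℂ = c :=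
  tendsto_nhds_unique (tendsto_inner_XLambda hA₀ ⟨x, hx⟩ k) h

/-- This is (*) paired with u, with V* and A₁ moved across the inner product. -/
theorem tendsto_inner_res_V (hA₁ : IsSelfAdjoint A₁)
    (hlim : ∀ k, LimitEquation A₀ A₁ V (y k) (lam k)) (u : H₁) (k : Fin n) :
    Tendsto (fun ε : ℝ => ⟪res A₀ ((lam k : ℂ) + Complex.I * (ε : ℂ)) (V (y k)), V u⟫_ℂ)
      (𝓝[>] 0) (𝓝 (⟪y k, A₁ u⟫_ℂ - lam k * ⟪y k, u⟫_ℂ)) := by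
  have h := Tendsto.inner (𝕜 := ℂ) (hlim k) (tendsto_const_nhds (x := u))
  simp only [ContinuousLinearMap.adjoint_inner_left] at h
  rw [inner_sub_left, inner_smul_left, inner_apply_left hA₁, Complex.conj_ofReal] at h
  exact h

/-- Move A₀ onto the resolvent and use A₀ R(z) = 1 + z R(z); the conjugate of z tends to the real
number `lam k`. -/
theorem tendsto_inner_res_apply (hA₀ : IsSelfAdjoint A₀)
    (x : (XLambda A₀ V hn y hy lam).domain) (k : Fin n) :
    Tendsto (fun ε : ℝ =>
      ⟪res A₀ ((lam k : ℂ) + Complex.I * (ε : ℂ)) (V (y k)), A₀ (x : H₀)⟫_ℂ) (𝓝[>] 0)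
      (𝓝 (⟪V (y k), (x : H₀)⟫_ℂ + lam k * ⟪y k, XLambda A₀ V hn y hy lam x⟫_ℂ)) := by
  have hz : Tendsto (fun ε : ℝ => starRingEnd ℂ ((lam k : ℂ) + Complex.I * (ε : ℂ))) (𝓝[>] 0)
      (𝓝 (lam k : ℂ)) := by
    have : Continuous fun ε : ℝ => starRingEnd ℂ ((lam k : ℂ) + Complex.I * (ε : ℂ)) :=
      Complex.continuous_conj.comp (by fun_prop)
    simpa using (this.tendsto 0).mono_left nhdsWithin_le_nhds
  refine (tendsto_const_nhds.add (hz.mul (tendsto_inner_XLambda hA₀ x k))).congr' ?_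
  filter_upwards [self_mem_nhdsWithin] with ε hε
  have hε' : ((lam k : ℂ) + Complex.I * (ε : ℂ)).im ≠ 0 := by
    simpa using (Set.mem_Ioi.1 hε).ne'
  rw [← inner_smul_left, ← inner_apply_left hA₀, ← inner_add_left]
  nth_rewrite 1 [← apply_res hA₀ hε' (V (y k))]
  rw [sub_add_cancel]

theorem V_mem_domain_XLambda (hA₀ : IsSelfAdjoint A₀) (hA₁ : IsSelfAdjoint A₁)
    (hlim : ∀ k, LimitEquation A₀ A₁ V (y k) (lam k)) (u : H₁) :
    V u ∈ (XLambda A₀ V hn y hy lam).domain :=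
  mem_domain_XLambda_of_tendsto hA₀ (tendsto_inner_res_V hA₁ hlim u)

theorem apply_mem_domain_XLambda (hA₀ : IsSelfAdjoint A₀) {x : H₀}
    (hx : x ∈ (XLambda A₀ V hn y hy lam).domain) : A₀ x ∈ (XLambda A₀ V hn y hy lam).domain :=
  mem_domain_XLambda_of_tendsto hA₀ (tendsto_inner_res_apply hA₀ ⟨x, hx⟩)

theorem inner_XLambda_apply (hA₀ : IsSelfAdjoint A₀) (x : (XLambda A₀ V hn y hy lam).domain)
    (hx : A₀ x ∈ (XLambda A₀ V hn y hy lam).domain) (k : Fin n) :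
    ⟪y k, XLambda A₀ V hn y hy lam ⟨A₀ x, hx⟩⟫_ℂ
      = ⟪V (y k), (x : H₀)⟫_ℂ + lam k * ⟪y k, XLambda A₀ V hn y hy lam x⟫_ℂ :=
  inner_XLambda_eq hA₀ hx (tendsto_inner_res_apply hA₀ x k)

theorem dense_domain_XLambda (hA₀ : IsSelfAdjoint A₀) (hA₁ : IsSelfAdjoint A₁)
    (hcyc : IsCyclicGenerating A₀ (LinearMap.range (V : H₁ →ₗ[ℂ] H₀)))
    (hlim : ∀ k, LimitEquation A₀ A₁ V (y k) (lam k)) :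
    Dense ((XLambda A₀ V hn y hy lam).domain : Set H₀) := by
  refine Dense.mono (SetLike.coe_subset_coe.2 (Submodule.span_le.2 ?_)) hcyc
  rintro _ ⟨k, _, ⟨u, rfl⟩, rfl⟩
  induction k with
  | zero => simpa using V_mem_domain_XLambda hA₀ hA₁ hlim u
  | succ k ih =>
    rw [pow_succ', ContinuousLinearMap.mul_def, ContinuousLinearMap.comp_apply]
    exact apply_mem_domain_XLambda hA₀ ih

theorem isStrongSolution_XLambda (hA₀ : IsSelfAdjoint A₀) (hA₁ : IsSelfAdjoint A₁)
    (hcyc : IsCyclicGenerating A₀ (LinearMap.range (V : H₁ →ₗ[ℂ] H₀)))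
    (hlim : ∀ k, LimitEquation A₀ A₁ V (y k) (lam k)) :
    IsStrongSolution A₀ A₁ V (XLambda A₀ V hn y hy lam) where
  dense_domain := dense_domain_XLambda hA₀ hA₁ hcyc hlim
  mapsTo x := Submodule.add_mem _ (apply_mem_domain_XLambda hA₀ x.2)
    (V_mem_domain_XLambda hA₀ hA₁ hlim _)
  equation x := by
    refine ext_inner_of_linearIndependent hn hy fun k => ?_
    -- The limits for A₀ x and V X x contribute +λ_k ⟨y_k, X x⟩ and -λ_k ⟨y_k, X x⟩, so the
    -- differing λ_k cancel coordinate by coordinate.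
    rw [inner_add_right, inner_sub_right, inner_XLambda_eq hA₀ _
      (((tendsto_inner_res_apply hA₀ x k).add (tendsto_inner_res_V hA₁ hlim
        (XLambda A₀ V hn y hy lam x) k)).congr fun ε => (inner_add_right _ _ _).symm),
      ContinuousLinearMap.adjoint_inner_right, inner_zero_right]
    ring

/-- By Cauchy–Schwarz each coordinate is at most √I ‖x‖ uniformly in ε; the inverse of `innerCoord`
turns this into a norm bound. -/
theorem isBoundedOp_XLambda (hA₀ : IsSelfAdjoint A₀)
    (hI : ∀ j, invSqIntegral A₀ (V (y j)) (lam j) < ∞) :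
    IsBoundedOp (XLambda A₀ V hn y hy lam) := by
  have hcoord : ∀ (k : Fin n) (x : (XLambda A₀ V hn y hy lam).domain),
      ‖⟪y k, XLambda A₀ V hn y hy lam x⟫_ℂ‖
        ≤ √(invSqIntegral A₀ (V (y k)) (lam k)).toReal * ‖(x : H₀)‖ := by
    intro k x
    refine le_of_tendsto (tendsto_inner_XLambda hA₀ x k).norm ?_
    filter_upwards [self_mem_nhdsWithin] with ε hε
    refine (norm_inner_le_norm _ _).trans
      (mul_le_mul_of_nonneg_right (Real.le_sqrt_of_sq_le ?_) (norm_nonneg _))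
    exact (ENNReal.ofReal_le_iff_le_toReal (hI k).ne).1
      (norm_res_sq_le_invSqIntegral hA₀ hε (V (y k)))
  set B : Fin n → ℝ := fun k => √(invSqIntegral A₀ (V (y k)) (lam k)).toReal with hB
  refine ⟨‖((innerCoord hn y hy).symm : (Fin n → ℂ) →L[ℂ] H₁)‖ * ∑ k, B k, fun x => ?_⟩
  have h1 : ‖innerCoord hn y hy (XLambda A₀ V hn y hy lam x)‖ ≤ (∑ k, B k) * ‖(x : H₀)‖ := by
    have hB0 : ∀ k ∈ Finset.univ, 0 ≤ B k := fun k _ => Real.sqrt_nonneg _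
    refine (pi_norm_le_iff_of_nonneg
      (mul_nonneg (Finset.sum_nonneg hB0) (norm_nonneg _))).2 fun k => ?_
    rw [innerCoord_apply]
    exact (hcoord k x).trans (mul_le_mul_of_nonneg_right
      (Finset.single_le_sum hB0 (Finset.mem_univ k)) (norm_nonneg _))
  calc ‖XLambda A₀ V hn y hy lam x‖
      = ‖((innerCoord hn y hy).symm : (Fin n → ℂ) →L[ℂ] H₁)
          (innerCoord hn y hy (XLambda A₀ V hn y hy lam x))‖ := by simp
    _ ≤ ‖((innerCoord hn y hy).symm : (Fin n → ℂ) →L[ℂ] H₁)‖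
          * ‖innerCoord hn y hy (XLambda A₀ V hn y hy lam x)‖ :=
        ContinuousLinearMap.le_opNorm _ _
    _ ≤ ‖((innerCoord hn y hy).symm : (Fin n → ℂ) →L[ℂ] H₁)‖ * ((∑ k, B k) * ‖(x : H₀)‖) :=
        mul_le_mul_of_nonneg_left h1 (norm_nonneg _)
    _ = _ := (mul_assoc _ _ _).symm

theorem invSqIntegral_lt_top_of_isBoundedOp (hA₀ : IsSelfAdjoint A₀)
    (hdense : Dense ((XLambda A₀ V hn y hy lam).domain : Set H₀))
    (hb : IsBoundedOp (XLambda A₀ V hn y hy lam)) (j : Fin n) :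
    invSqIntegral A₀ (V (y j)) (lam j) < ∞ := by
  obtain ⟨C, hC⟩ := hb
  -- The bounded functional x ↦ ⟨y_j, X x⟩ is extended to the whole space and represented by a
  -- vector w.
  let f : StrongDual ℂ (XLambda A₀ V hn y hy lam).domain :=
    (innerSL ℂ (y j)).comp ((XLambda A₀ V hn y hy lam).toFun.mkContinuous C hC)
  obtain ⟨g, hg, -⟩ := exists_extension_norm_eq _ f
  set w : H₀ := (InnerProductSpace.toDual ℂ H₀).symm g with hw
  have hwx : ∀ x : (XLambda A₀ V hn y hy lam).domain,
      ⟪w, (x : H₀)⟫_ℂ = ⟪y j, XLambda A₀ V hn y hy lam x⟫_ℂ := fun x => by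
    rw [hw, InnerProductSpace.toDual_symm_apply, hg x]; rfl
  -- Tested against the dense domain, where its invariance under A₀ allows w to be paired with A₀ x.
  have heq : A₀ w - (lam j : ℂ) • w = V (y j) := by
    refine hdense.eq_of_inner_left ℂ fun x hx => ?_
    have hAx := apply_mem_domain_XLambda hA₀ hx
    have h1 := hwx ⟨A₀ x, hAx⟩
    rw [inner_XLambda_apply hA₀ ⟨x, hx⟩ hAx j, ← hwx ⟨x, hx⟩] at h1
    rw [inner_sub_left, inner_smul_left, inner_apply_left hA₀, Complex.conj_ofReal]
    exact sub_eq_of_eq_add h1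
  exact (invSqIntegral_le_of_norm_res_le hA₀ fun ε hε =>
    norm_res_le_of_eq hA₀ hε heq).trans_lt ENNReal.ofReal_lt_top

end Riccati

end

theorem mainTheorem3 {H₀ H₁ : Type*}
    [NormedAddCommGroup H₀] [InnerProductSpace ℂ H₀] [CompleteSpace H₀]
    [NormedAddCommGroup H₁] [InnerProductSpace ℂ H₁] [CompleteSpace H₁]
    [FiniteDimensional ℂ H₁]
    (A₀ : H₀ →L[ℂ] H₀) (hA₀ : IsSelfAdjoint A₀)
    (A₁ : H₁ →L[ℂ] H₁) (hA₁ : IsSelfAdjoint A₁)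
    (V : H₁ →L[ℂ] H₀)
    (hcyc : Riccati.IsCyclicGenerating A₀ (LinearMap.range (V : H₁ →ₗ[ℂ] H₀)))
    (n : ℕ) (hn : n = Module.finrank ℂ H₁)
    (y : Fin n → H₁) (hy : LinearIndependent ℂ y) (lam : Fin n → ℝ)
    (hlim : ∀ k, Riccati.LimitEquation A₀ A₁ V (y k) (lam k))
    (hlam : ∀ k, lam k ∈ Riccati.Kpp A₀ A₁ V ∪ Riccati.Ksc A₀ A₁ V) :
    Dense ((Riccati.XLambda A₀ V hn y hy lam).domain : Set H₀) ∧
    ((∃ j, Riccati.invSqIntegral A₀ (V (y j)) (lam j) = ∞) →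
      ¬ Riccati.IsBoundedOp (Riccati.XLambda A₀ V hn y hy lam) ∧
      ¬ (Riccati.XLambda A₀ V hn y hy lam).IsClosable) ∧
    ((∀ j, Riccati.invSqIntegral A₀ (V (y j)) (lam j) < ∞) →
      Riccati.IsBoundedOp (Riccati.XLambda A₀ V hn y hy lam)) ∧
    (∀ x ∈ (Riccati.XLambda A₀ V hn y hy lam).domain,
      A₀ x ∈ (Riccati.XLambda A₀ V hn y hy lam).domain) ∧
    Riccati.IsStrongSolution A₀ A₁ V (Riccati.XLambda A₀ V hn y hy lam) := by
  have hdense := Riccati.dense_domain_XLambda (hn := hn) (hy := hy) hA₀ hA₁ hcyc hlim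
  have hunb : (∃ j, Riccati.invSqIntegral A₀ (V (y j)) (lam j) = ∞) →
      ¬ Riccati.IsBoundedOp (Riccati.XLambda A₀ V hn y hy lam) := fun ⟨j, hj⟩ hb =>
    (Riccati.invSqIntegral_lt_top_of_isBoundedOp hA₀ hdense hb j).ne hj
  exact ⟨hdense,
    fun hj => ⟨hunb hj, fun hc => hunb hj (Riccati.isBoundedOp_of_isClosable hc)⟩,
    Riccati.isBoundedOp_XLambda hA₀,
    fun _ hx => Riccati.apply_mem_domain_XLambda hA₀ hx,
    Riccati.isStrongSolution_XLambda hA₀ hA₁ hcyc hlim⟩
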